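/- For $n\ge 1$ let $\overline{H}_n=\sum_{k=1}^n \frac{(-1)^{k-1}}{k}$ be the $n$th skew-harmonic number and let $H_n^{(3)}=\sum_{k=1}^n \frac{1}{k^3}$. Let $\zeta$ be the Riemann zeta function and $\mathrm{Li}_s(z)=\sum_{n=1}^\infty \frac{z^n}{n^s}$ the polylogarithm of order $s$. Then the series below converges and $$\sum_{n=1}^\infty \frac{\overline{H}_n}{n}\left(\zeta(3)-H_n^{(3)}\right)=\frac{193}{64}\zeta(5)-\frac{5}{16}\zeta(2)\zeta(3)-\frac{\log^5 2}{15}+\frac13\log^3(2)\,\zeta(2)-\frac{15}{16}\log(2)\,\zeta(4)-2\log(2)\,\mathrm{Li}_4\!\left(\tfrac12\right)-2\,\mathrm{Li}_5\!\left(\tfrac12\right).$$ -/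

import Mathlib

noncomputable section

namespace SkewHarmonicSeries

/-- The generalized harmonic number `H_n^{(p)} = 1 + 1/2^p + ⋯ + 1/n^p`. -/
def genHarmonic (p n : ℕ) : ℝ := ∑ k ∈ Finset.range n, 1 / ((k : ℝ) + 1) ^ p

/-- The skew-harmonic number `1 - 1/2 + ⋯ + (-1)^(n-1)/n`. -/
def skewHarmonic (n : ℕ) : ℝ := ∑ k ∈ Finset.range n, (-1 : ℝ) ^ k / ((k : ℝ) + 1)

/-- The polylogarithm `Li_s(x) = ∑_{n ≥ 1} x^n / n^s` of integer order `s`, at real `x`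
(used here only for `|x| < 1`, where the series converges absolutely). -/
def polylog (s : ℕ) (x : ℝ) : ℝ := ∑' n : ℕ, x ^ (n + 1) / ((n : ℝ) + 1) ^ s

/-- The Riemann zeta value `ζ(k)` as a real number; it is real for integers `k ≥ 2`
by `ofReal_zeta`. -/
def zeta (k : ℕ) : ℝ := (riemannZeta (k : ℂ)).re

/-- For `k ≥ 2` no information is lost by passing to the real part. -/
theorem ofReal_zeta (k : ℕ) (hk : 1 < k) : ((zeta k : ℝ) : ℂ) = riemannZeta (k : ℂ) := by
  have h : riemannZeta (k : ℂ) = ((∑' n : ℕ, 1 / (n : ℝ) ^ k : ℝ) : ℂ) := by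
    rw [zeta_nat_eq_tsum_of_gt_one hk]
    push_cast
    rfl
  rw [zeta, h, Complex.ofReal_re]

end SkewHarmonicSeries

end

/-! Summation by parts turns the series into `∑ P(m) / (m + 1)^3` with `P(m) = ∑_{n ≤ m} H̄_n / n`.
This is `-ζ(3, 1, 1̄) - ζ(3, 2̄)`, where a bar marks a sign `(-1)^n` and the largest summation
variable comes first (`sum_eq_seriesLin_add`, `hasSum_seriesLin`). The constants on the other side
are alternating multiple zeta values too: `log 2 = -ζ(1̄)`, and `Li_s(1/2)` becomes an iterated
integral over the unit interval after the substitution `y = x / (1 + x)`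
(`evalSeries_polylogWords`). The claim is thus a relation in weight five.

Such relations come from two ways of multiplying. Nested sums multiply by the quasi-shuffle product,
exactly at every truncation `N` (`nestedSum_mul`). Their limits are also boundary values at `1` of
iterated integrals of `dx/x`, `dx/(1+x)`, `dx/(1-x)` (`tendsto_evalSeries_wordSeries`), which
multiply by the shuffle product (`wordSeries_mul`). The difference of the two products, like the
relation obtained from the even denominators (`eta_relation`), tends to zero, and still does after
multiplication by a further convergent sum (`Relation.tendsto_zero`).

Integer multiples of these relations, listed in `certificate`, add up to `960` times the claim. This
is a formal identity between combinations of indices, verified by computation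
(`isZero_certificate`); letting `N` tend to infinity gives `seriesLin_value`. -/

noncomputable section

namespace SkewHarmonicSeries

open Filter Topology

/-! ### Multiple harmonic sums and the quasi-shuffle product -/

/-- An index `[(s₁, e₁), …, (s_k, e_k)]` of an alternating multiple harmonic sum; the flag `e_i`
tells whether the sign `(-1) ^ n_i` is present. -/
abbrev Index := List (ℕ × Bool)

/-- The summand `(±1) ^ (n + 1) / (n + 1) ^ s`. -/
def term (p : ℕ × Bool) (n : ℕ) : ℝ :=
  (if p.2 then (-1) ^ (n + 1) else 1) / ((n : ℝ) + 1) ^ p.1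

/-- The alternating multiple harmonic sum over `N ≥ n₁ > n₂ > ⋯ > n_k ≥ 1`. -/
def nestedSum : Index → ℕ → ℝ
  | [], _ => 1
  | p :: t, N => ∑ n ∈ Finset.range N, term p n * nestedSum t n

theorem nestedSum_nil (N : ℕ) : nestedSum [] N = 1 := rfl

theorem nestedSum_cons (p : ℕ × Bool) (t : Index) (N : ℕ) :
    nestedSum (p :: t) N = ∑ n ∈ Finset.range N, term p n * nestedSum t n := rfl

theorem nestedSum_cons_zero (p : ℕ × Bool) (t : Index) : nestedSum (p :: t) 0 = 0 := by
  simp [nestedSum_cons]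

theorem nestedSum_cons_succ (p : ℕ × Bool) (t : Index) (N : ℕ) :
    nestedSum (p :: t) (N + 1) = nestedSum (p :: t) N + term p N * nestedSum t N := by
  simp [nestedSum_cons, Finset.sum_range_succ]

/-- Pointwise product of two entries of an index. -/
def merge (p q : ℕ × Bool) : ℕ × Bool := (p.1 + q.1, xor p.2 q.2)

theorem term_merge (p q : ℕ × Bool) (n : ℕ) : term (merge p q) n = term p n * term q n := by
  obtain ⟨s, e⟩ := p
  obtain ⟨s', e'⟩ := q
  have h : ((-1 : ℝ) ^ n) * (-1) ^ n = 1 := by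
    rw [← mul_pow]; simp
  have hs : ((n : ℝ) + 1) ^ (s + s') = (n + 1) ^ s * (n + 1) ^ s' := pow_add _ _ _
  simp only [term, merge]
  rw [hs, div_mul_div_comm]
  cases e <;> cases e' <;> simp [pow_succ, h]

/-- One level of the recursion defining `stuffle`. -/
def stuffleCons (p : ℕ × Bool) (u : Index) (f : Index → List Index) : Index → List Index
  | [] => [p :: u]
  | q :: v => (f (q :: v)).map (p :: ·) ++
      ((stuffleCons p u f v).map (q :: ·) ++ (f v).map (merge p q :: ·))

/-- The quasi-shuffle product of two indices. -/
def stuffle : Index → Index → List Index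
  | [] => fun v => [v]
  | p :: u => stuffleCons p u (stuffle u)

theorem stuffle_nil_right (u : Index) : stuffle u [] = [u] := by
  cases u <;> rfl

theorem stuffle_cons_cons (p q : ℕ × Bool) (u v : Index) :
    stuffle (p :: u) (q :: v) = (stuffle u (q :: v)).map (p :: ·) ++
      ((stuffle (p :: u) v).map (q :: ·) ++ (stuffle u v).map (merge p q :: ·)) := rfl

theorem sum_nestedSum_map_cons_succ (p : ℕ × Bool) (l : List Index) (N : ℕ) :
    ((l.map (p :: ·)).map (nestedSum · (N + 1))).sum =
      ((l.map (p :: ·)).map (nestedSum · N)).sum + term p N * (l.map (nestedSum · N)).sum := by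
  induction l with
  | nil => simp
  | cons w l ih =>
    simp only [List.map_cons, List.sum_cons] at ih ⊢
    rw [ih, nestedSum_cons_succ]
    ring

theorem sum_nestedSum_map_cons_zero (p : ℕ × Bool) (l : List Index) :
    ((l.map (p :: ·)).map (nestedSum · 0)).sum = 0 := by
  induction l with
  | nil => simp
  | cons w l ih =>
    simp only [List.map_cons, List.sum_cons] at ih ⊢
    rw [ih, nestedSum_cons_zero, add_zero]

/-- Multiple harmonic sums multiply by the quasi-shuffle product. -/
theorem nestedSum_mul (N : ℕ) (u v : Index) :
    nestedSum u N * nestedSum v N = ((stuffle u v).map (nestedSum · N)).sum := by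
  induction N generalizing u v with
  | zero =>
    cases u with
    | nil => simp [stuffle, nestedSum_nil]
    | cons p u =>
      cases v with
      | nil => simp [stuffle_nil_right, nestedSum_nil]
      | cons q v =>
        simp only [stuffle_cons_cons, List.map_append, List.sum_append,
          sum_nestedSum_map_cons_zero, nestedSum_cons_zero]
        simp
  | succ N ih =>
    cases u with
    | nil => simp [stuffle, nestedSum_nil]
    | cons p u =>
      cases v with
      | nil => simp [stuffle_nil_right, nestedSum_nil]
      | cons q v =>
        have h := ih (p :: u) (q :: v)
        simp only [stuffle_cons_cons, List.map_append, List.sum_append,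
          sum_nestedSum_map_cons_succ] at h ⊢
        -- From `N` to `N + 1` a product of two sums grows by two mixed terms and the product of the
        -- increments. These are the three parts of the quasi-shuffle recursion.
        rw [← ih u (q :: v), ← ih (p :: u) v, ← ih u v, nestedSum_cons_succ, nestedSum_cons_succ,
          term_merge]
        linear_combination h

/-! ### Formal integral combinations of indices -/

/-- Equality test for indices. -/
def Index.eqb : Index → Index → Bool
  | [], [] => true
  | [], _ :: _ => false
  | _ :: _, [] => false
  | p :: u, q :: v => Nat.beq p.1 q.1 && (p.2 == q.2 && eqb u v)

/-- Soundness is the only direction needed: a missed equality would leave like terms uncollected but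
change no value. -/
theorem Index.eq_of_eqb : ∀ {u v : Index}, u.eqb v = true → u = v
  | [], [], _ => rfl
  | [], _ :: _, h => by simp [eqb] at h
  | _ :: _, [], h => by simp [eqb] at h
  | (s, e) :: u, (s', e') :: v, h => by
    simp only [eqb, Bool.and_eq_true, beq_iff_eq] at h
    rw [Nat.eq_of_beq_eq_true h.1, h.2.1, eq_of_eqb h.2.2]

/-- A lexicographic order on indices. -/
def Index.ltb : Index → Index → Bool
  | [], [] => false
  | [], _ :: _ => true
  | _ :: _, [] => false
  | p :: u, q :: v =>
    bif Nat.beq p.1 q.1 then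
      match p.2, q.2 with
      | false, true => true
      | true, false => false
      | _, _ => ltb u v
    else Nat.ble p.1 q.1

/-- Formal integral linear combinations of indices. -/
abbrev Lin := List (ℤ × Index)

namespace Lin

/-- The value of a formal combination, with all sums truncated at `N`. -/
def evalAt (x : Lin) (N : ℕ) : ℝ := (x.map fun p => (p.1 : ℝ) * nestedSum p.2 N).sum

/-- Scalar multiplication. -/
def scale (k : ℤ) (x : Lin) : Lin := x.map fun p => (k * p.1, p.2)

/-- One level of the recursion defining `add`. -/
def addCons (p : ℤ × Index) (f : Lin → Lin) : Lin → Lin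
  | [] => p :: f []
  | q :: y =>
    bif p.2.eqb q.2 then (p.1 + q.1, p.2) :: f y
    else bif p.2.ltb q.2 then p :: f (q :: y)
    else q :: addCons p f y

/-- Addition; it merges ordered combinations into an ordered one. -/
def add : Lin → Lin → Lin
  | [] => fun y => y
  | p :: x => addCons p (add x)

/-- Sort a combination and collect like terms. -/
def collect (x : Lin) : Lin := x.foldr (fun p => add [p]) []

/-- The bilinear extension of the quasi-shuffle product. -/
def mul (x y : Lin) : Lin :=
  collect (x.flatMap fun p => y.flatMap fun q => (stuffle p.2 q.2).map fun t => (p.1 * q.1, t))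

theorem evalAt_nil (N : ℕ) : evalAt [] N = 0 := rfl

theorem evalAt_cons (p : ℤ × Index) (x : Lin) (N : ℕ) :
    evalAt (p :: x) N = p.1 * nestedSum p.2 N + evalAt x N := rfl

theorem evalAt_append (x y : Lin) (N : ℕ) : evalAt (x ++ y) N = evalAt x N + evalAt y N := by
  simp [evalAt]

theorem evalAt_scale (k : ℤ) (x : Lin) (N : ℕ) : evalAt (scale k x) N = k * evalAt x N := by
  induction x with
  | nil => simp [scale, evalAt]
  | cons p x ih =>
    simp only [scale, List.map_cons, evalAt_cons] at ih ⊢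
    rw [ih]; push_cast; ring

/-- Holds whether or not the inputs are sorted, so no property of `Index.ltb` enters. The order only
helps like terms to meet, so that cancellation becomes visible to `isZero`. -/
theorem evalAt_add (x y : Lin) (N : ℕ) : evalAt (add x y) N = evalAt x N + evalAt y N := by
  induction x generalizing y with
  | nil => simp [add, evalAt]
  | cons p x ih =>
    change evalAt (addCons p (add x) y) N = _
    induction y with
    | nil => simp only [addCons, evalAt_cons, ih]; ring
    | cons q y ihy =>
      rw [addCons]
      cases h : p.2.eqb q.2
      · cases p.2.ltb q.2
        · simp only [cond_false, evalAt_cons, ihy]; ring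
        · simp only [cond_false, cond_true, evalAt_cons, ih]; ring
      · simp only [cond_true, evalAt_cons, ih, Index.eq_of_eqb h]; push_cast; ring

theorem evalAt_collect (x : Lin) (N : ℕ) : evalAt (collect x) N = evalAt x N := by
  induction x with
  | nil => rfl
  | cons p x ih =>
    change evalAt (add [p] (collect x)) N = _
    rw [evalAt_add, ih]
    simp [evalAt]

theorem evalAt_map_pair (k : ℤ) (l : List Index) (N : ℕ) :
    evalAt (l.map fun t => (k, t)) N = k * (l.map (nestedSum · N)).sum := by
  induction l with
  | nil => simp [evalAt]
  | cons t l ih =>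
    simp only [List.map_cons, evalAt_cons, List.sum_cons] at ih ⊢
    rw [ih]; ring

theorem evalAt_mul (x y : Lin) (N : ℕ) : evalAt (mul x y) N = evalAt x N * evalAt y N := by
  have h (p : ℤ × Index) (y : Lin) :
      evalAt (y.flatMap fun q => (stuffle p.2 q.2).map fun t => (p.1 * q.1, t)) N =
        p.1 * nestedSum p.2 N * evalAt y N := by
    induction y with
    | nil => simp [evalAt]
    | cons q y ih =>
      rw [List.flatMap_cons, evalAt_append, ih, evalAt_map_pair, ← nestedSum_mul, evalAt_cons]
      push_cast; ring
  rw [mul, evalAt_collect]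
  induction x with
  | nil => simp [evalAt]
  | cons p x ih =>
    rw [List.flatMap_cons, evalAt_append, h, evalAt_cons, ih]
    ring

/-- All coefficients vanish. -/
def isZero (x : Lin) : Bool := x.all fun p => p.1 == 0

theorem evalAt_eq_zero {x : Lin} (h : x.isZero = true) (N : ℕ) : evalAt x N = 0 := by
  simp only [isZero, List.all_eq_true, beq_iff_eq] at h
  refine List.sum_eq_zero fun r hr => ?_
  obtain ⟨p, hp, rfl⟩ := List.mem_map.1 hr
  rw [h p hp]; simp

end Lin

/-! ### Words in the differential forms and the shuffle product -/

/-- The differential forms `dx / x`, `dx / (1 + x)` and `dx / (1 - x)`. -/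
inductive Letter
  | a
  | b
  | c
  deriving DecidableEq

/-- One level of the recursion defining `shuffle`. -/
def shuffleCons (l : Letter) (u : List Letter) (f : List Letter → List (List Letter)) :
    List Letter → List (List Letter)
  | [] => [l :: u]
  | m :: v => (f (m :: v)).map (l :: ·) ++ (shuffleCons l u f v).map (m :: ·)

/-- The shuffle product of two words. -/
def shuffle : List Letter → List Letter → List (List Letter)
  | [] => fun v => [v]
  | l :: u => shuffleCons l u (shuffle u)

theorem shuffle_nil_right (u : List Letter) : shuffle u [] = [u] := by
  cases u <;> rfl

theorem shuffle_cons_cons (l m : Letter) (u v : List Letter) :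
    shuffle (l :: u) (m :: v) =
      (shuffle u (m :: v)).map (l :: ·) ++ (shuffle (l :: u) v).map (m :: ·) := rfl

/-- Change the alternation flag of the first entry. -/
def flipHead : Index → Index
  | [] => []
  | p :: t => (p.1, !p.2) :: t

/-- Increase the exponent of the first entry by one. -/
def bumpHead : Index → Index
  | [] => []
  | p :: t => (p.1 + 1, p.2) :: t

/-- The sign and the index of the multiple harmonic sum attached to a word. -/
def toIndex : List Letter → ℤ × Index
  | [] => (1, [])
  | .a :: w => ((toIndex w).1, bumpHead (toIndex w).2)
  | .b :: w => (-(toIndex w).1, (1, true) :: flipHead (toIndex w).2)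
  | .c :: w => ((toIndex w).1, (1, false) :: (toIndex w).2)

/-- The words, with signs, of the iterated integral representing `Li_s (x / (1 + x))`. -/
def polylogWords : ℕ → List (ℤ × List Letter)
  | 0 => []
  | 1 => [(1, [.b])]
  | s + 2 => (polylogWords (s + 1)).map (fun p => (p.1, .a :: p.2)) ++
      (polylogWords (s + 1)).map (fun p => (-p.1, .b :: p.2))

/-- The formal combination of indices attached to a formal combination of words. -/
def wordsToLin (x : List (ℤ × List Letter)) : Lin :=
  x.map fun p => (p.1 * (toIndex p.2).1, (toIndex p.2).2)

/-! ### Relations and the certificate -/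

/-- Linear relations between alternating multiple zeta values. -/
inductive Relation
  /-- Shuffle minus quasi-shuffle product of two words, times a further index. -/
  | doubleShuffle (u v : List Letter) (t : Index)
  /-- The relation between `ζ(s)` and its alternating companion, times a further index. -/
  | eta (s : ℕ) (t : Index)

/-- The formal combination that a relation asserts to vanish in the limit. -/
def Relation.toLin : Relation → Lin
  | doubleShuffle u v t =>
      Lin.mul (Lin.add (Lin.collect (wordsToLin ((shuffle u v).map fun w => (1, w))))
        (Lin.scale (-1) (Lin.mul [toIndex u] [toIndex v]))) [(1, t)]
  | eta s t =>
      Lin.mul [(2 ^ (s - 1) - 1, [(s, false)]), (2 ^ (s - 1), [(s, true)])] [(1, t)]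

/-- The combination of relations that reduces the series to zeta values and polylogarithms. -/
def certificate : List (ℤ × Relation) :=
  [(1920, .eta 2 [(1, true), (1, false), (1, false)]),
   (-400, .eta 2 [(3, true)]),
   (-60, .eta 3 [(2, false)]),
   (-60, .eta 4 [(1, true)]),
   (15, .eta 5 []),
   (-720, .doubleShuffle [.a, .b] [.a, .a, .c] []),
   (240, .doubleShuffle [.a, .b] [.a, .b] [(1, true)]),
   (-720, .doubleShuffle [.a, .b] [.a, .c, .b] []),
   (-2240, .doubleShuffle [.a, .b] [.b, .b] [(1, true)]),
   (960, .doubleShuffle [.a, .b] [.b, .b, .c] []),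
   (-1920, .doubleShuffle [.a, .b] [.b, .c] [(1, true)]),
   (960, .doubleShuffle [.a, .c] [.a, .a, .b] []),
   (-240, .doubleShuffle [.a, .c] [.b, .a, .b] []),
   (-1920, .doubleShuffle [.a, .c] [.b, .b, .b] []),
   (480, .doubleShuffle [.a, .c] [.b, .c] [(1, true)]),
   (960, .doubleShuffle [.a, .c] [.b, .c, .b] []),
   (-2160, .doubleShuffle [.b] [.a, .a, .a, .b] []),
   (-1680, .doubleShuffle [.b] [.a, .a, .a, .c] []),
   (6720, .doubleShuffle [.b] [.a, .b, .b, .b] []),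
   (480, .doubleShuffle [.b] [.a, .b, .b, .c] []),
   (1200, .doubleShuffle [.b] [.a, .c, .a, .b] []),
   (480, .doubleShuffle [.b] [.a, .c, .c] [(1, true)]),
   (480, .doubleShuffle [.b] [.a, .c, .c, .b] []),
   (384, .doubleShuffle [.b] [.b] [(1, true), (1, true), (1, true)]),
   (256, .doubleShuffle [.b] [.b] [(1, true), (1, true), (1, false)]),
   (128, .doubleShuffle [.b] [.b] [(1, true), (1, false), (1, true)]),
   (288, .doubleShuffle [.b] [.b] [(1, true), (2, true)]),
   (-128, .doubleShuffle [.b] [.b] [(1, true), (2, false)]),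
   (160, .doubleShuffle [.b] [.b] [(2, true), (1, true)]),
   (-1440, .doubleShuffle [.b] [.b] [(2, true), (1, false)]),
   (-288, .doubleShuffle [.b] [.b] [(2, false), (1, true)]),
   (-352, .doubleShuffle [.b] [.b] [(2, false), (1, false)]),
   (64, .doubleShuffle [.b] [.b] [(3, true)]),
   (1600, .doubleShuffle [.b] [.b] [(3, false)]),
   (1920, .doubleShuffle [.b] [.b, .a, .a, .b] []),
   (160, .doubleShuffle [.b] [.b, .a, .b] [(1, true)]),
   (3200, .doubleShuffle [.b] [.b, .a, .b, .b] []),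
   (960, .doubleShuffle [.b] [.b, .a, .b, .c] []),
   (1920, .doubleShuffle [.b] [.b, .b] [(2, true)]),
   (384, .doubleShuffle [.b] [.b, .b, .b, .b] []),
   (1920, .doubleShuffle [.b, .b] [.a, .a, .c] []),
   (-4800, .doubleShuffle [.b, .b] [.a, .b, .b] []),
   (-1920, .doubleShuffle [.b, .b] [.a, .b, .c] []),
   (-640, .doubleShuffle [.b, .b] [.b, .a, .b] []),
   (256, .doubleShuffle [.b, .b] [.b, .b] [(1, true)]),
   (-480, .doubleShuffle [.b, .c] [.a, .a, .b] []),
   (480, .doubleShuffle [.b, .c] [.a, .b, .b] [])]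

/-- The logarithm of two. -/
def logTwoLin : Lin := [(-1, [(1, true)])]

/-- The zeta value at `s`. -/
def zetaLin (s : ℕ) : Lin := [(1, [(s, false)])]

/-- The polylogarithm of order `s` at one half. -/
def polylogLin (s : ℕ) : Lin := wordsToLin (polylogWords s)

/-- The series under consideration. -/
def seriesLin : Lin := [(-1, [(3, false), (1, false), (1, true)]), (-1, [(3, false), (2, true)])]

/-- `960` times the difference of the two sides of the evaluation. -/
def targetLin : Lin :=
  Lin.add (Lin.collect (Lin.scale 960 seriesLin)) <|
  Lin.add (Lin.scale (-2895) (zetaLin 5)) <|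
  Lin.add (Lin.scale 300 (Lin.mul (zetaLin 2) (zetaLin 3))) <|
  Lin.add (Lin.scale 64 (Lin.mul logTwoLin (Lin.mul logTwoLin
    (Lin.mul logTwoLin (Lin.mul logTwoLin logTwoLin))))) <|
  Lin.add (Lin.scale (-320) (Lin.mul logTwoLin (Lin.mul logTwoLin
    (Lin.mul logTwoLin (zetaLin 2))))) <|
  Lin.add (Lin.scale 900 (Lin.mul logTwoLin (zetaLin 4))) <|
  Lin.add (Lin.scale 1920 (Lin.mul logTwoLin (polylogLin 4))) <|
  Lin.collect (Lin.scale 1920 (polylogLin 5))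

/-- The combination prescribed by a certificate. -/
def certificateLin (x : List (ℤ × Relation)) : Lin :=
  x.foldr (fun p => Lin.add (Lin.scale p.1 p.2.toLin)) []

/-- The whole linear algebra of the evaluation, over the integers and free of analysis. The products
are built from nested structural recursions so that the kernel can evaluate them. -/
theorem isZero_certificate :
    (Lin.add targetLin (Lin.scale (-1) (certificateLin certificate))).isZero = true := by
  decide +kernel

/-! ### Growth and convergence of multiple harmonic sums -/

/-- All exponents of an index are positive. -/
def Index.Pos (t : Index) : Prop := ∀ p ∈ t, 1 ≤ p.1

theorem abs_term_le (p : ℕ × Bool) {k : ℕ} (hp : k ≤ p.1) (n : ℕ) :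
    |term p n| ≤ 1 / ((n : ℝ) + 1) ^ k := by
  have h1 : |(if p.2 then (-1 : ℝ) ^ (n + 1) else 1)| = 1 := by split_ifs <;> simp
  have h0 : (0 : ℝ) < n + 1 := by positivity
  rw [term, abs_div, h1, abs_of_pos (by positivity : (0 : ℝ) < (n + 1) ^ p.1)]
  exact one_div_le_one_div_of_le (by positivity)
    (pow_le_pow_right₀ (by linarith [n.cast_nonneg (α := ℝ)]) hp)

theorem sum_inv_sqrt_le (N : ℕ) :
    ∑ n ∈ Finset.range N, 1 / √((n : ℝ) + 1) ≤ 2 * √N := by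
  induction N with
  | zero => simp
  | succ N ih =>
    rw [Finset.sum_range_succ]
    push_cast
    have h1 : 0 < √((N : ℝ) + 1) := by positivity
    have h2 : 0 ≤ √(N : ℝ) := by positivity
    have e1 : √((N : ℝ) + 1) ^ 2 = N + 1 := Real.sq_sqrt (by positivity)
    have e2 : √(N : ℝ) ^ 2 = N := Real.sq_sqrt (by positivity)
    have h3 : 1 / √((N : ℝ) + 1) ≤ 2 * √((N : ℝ) + 1) - 2 * √N := by
      rw [div_le_iff₀ h1]
      -- Once the denominator is cleared, the two sides differ by exactly this square.
      nlinarith [sq_nonneg (√((N : ℝ) + 1) - √N)]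
    linarith

/-- A crude growth bound for multiple harmonic sums. -/
theorem abs_nestedSum_le {t : Index} (ht : t.Pos) (N : ℕ) :
    |nestedSum t N| ≤ 2 ^ t.length * √((N : ℝ) + 1) := by
  induction t generalizing N with
  | nil =>
    rw [nestedSum_nil, abs_one, List.length_nil, pow_zero, one_mul, Real.one_le_sqrt]
    linarith [N.cast_nonneg (α := ℝ)]
  | cons p t ih =>
    have htt : Index.Pos t := fun q hq => ht q (List.mem_cons_of_mem _ hq)
    have hp : 1 ≤ p.1 := ht p List.mem_cons_self
    calc |nestedSum (p :: t) N|
        ≤ ∑ n ∈ Finset.range N, |term p n * nestedSum t n| := Finset.abs_sum_le_sum_abs _ _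
      -- The true growth is a power of a logarithm. The square root is preserved by the induction:
      -- `1 / (n + 1)` times `√(n + 1)` sums to at most `2 √N`, so each entry costs a factor `2`.
      _ ≤ ∑ n ∈ Finset.range N, 2 ^ t.length * (1 / √((n : ℝ) + 1)) := by
          refine Finset.sum_le_sum fun n _ => ?_
          rw [abs_mul]
          have h0 : 0 < √((n : ℝ) + 1) := by positivity
          have e : √((n : ℝ) + 1) ^ 2 = n + 1 := Real.sq_sqrt (by positivity)
          calc |term p n| * |nestedSum t n|
              ≤ 1 / ((n : ℝ) + 1) ^ 1 * (2 ^ t.length * √((n : ℝ) + 1)) :=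
                mul_le_mul (abs_term_le p hp n) (ih htt n) (abs_nonneg _) (by positivity)
            _ = 2 ^ t.length * (1 / √((n : ℝ) + 1)) := by
                rw [pow_one]
                nth_rewrite 1 [← e]
                field_simp
      _ ≤ 2 ^ t.length * (2 * √N) := by
          rw [← Finset.mul_sum]
          exact mul_le_mul_of_nonneg_left (sum_inv_sqrt_le N) (by positivity)
      _ ≤ 2 ^ (p :: t).length * √((N : ℝ) + 1) := by
          rw [List.length_cons, pow_succ, mul_assoc]
          gcongr
          linarith

theorem abs_term_mul_nestedSum_le {p : ℕ × Bool} {k : ℕ} (hp : k ≤ p.1) {t : Index} (ht : t.Pos)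
    (n : ℕ) :
    |term p n * nestedSum t n| ≤ 1 / ((n : ℝ) + 1) ^ k * (2 ^ t.length * √((n : ℝ) + 1)) := by
  rw [abs_mul]
  exact mul_le_mul (abs_term_le p hp n) (abs_nestedSum_le ht n) (abs_nonneg _) (by positivity)

theorem summable_sqrt_div_sq :
    Summable fun n : ℕ => √((n : ℝ) + 1) / ((n : ℝ) + 1) ^ 2 := by
  have h : Summable fun n : ℕ => 1 / ((n : ℝ)) ^ (3 / 2 : ℝ) :=
    Real.summable_one_div_nat_rpow.2 (by norm_num)
  refine ((summable_nat_add_iff 1).2 h).congr fun n => ?_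
  have h0 : (0 : ℝ) < n + 1 := by positivity
  push_cast
  rw [Real.sqrt_eq_rpow, ← Real.rpow_natCast, ← Real.rpow_sub h0, one_div, ← Real.rpow_neg h0.le]
  norm_num

/-- Alternating series whose terms tend to zero with bounded variation converge. -/
theorem exists_tendsto_sum_alternating {A : ℕ → ℝ} (h0 : Tendsto A atTop (𝓝 0))
    (h : Summable fun n => |A n - A (n + 1)|) :
    ∃ l, Tendsto (fun N => ∑ n ∈ Finset.range N, (-1) ^ n * A n) atTop (𝓝 l) := by
  -- The alternating sum is averaged with its own shift by one, which replaces `A n` by its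
  -- differences.
  have key (N : ℕ) : ∑ n ∈ Finset.range N, (-1) ^ n * A n =
      (∑ n ∈ Finset.range N, (-1) ^ n * (A n - A (n + 1)) + A 0 - (-1) ^ N * A N) / 2 := by
    induction N with
    | zero => simp
    | succ N ih => rw [Finset.sum_range_succ, Finset.sum_range_succ, ih, pow_succ]; ring
  have hs : Summable fun n => (-1 : ℝ) ^ n * (A n - A (n + 1)) :=
    Summable.of_norm (by simpa [abs_mul] using h)
  have hz : Tendsto (fun N => (-1 : ℝ) ^ N * A N) atTop (𝓝 0) := by
    rw [tendsto_zero_iff_abs_tendsto_zero]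
    simpa [Function.comp_def, abs_mul] using h0.abs
  refine ⟨_, (((hs.hasSum.tendsto_sum_nat.add_const (A 0)).sub hz).div_const 2).congr fun N => ?_⟩
  exact (key N).symm

/-- The indices whose multiple harmonic sums are shown to converge. -/
def Index.Admissible : Index → Prop
  | [] => True
  | p :: t => (2 ≤ p.1 ∨ p = (1, true)) ∧ Index.Pos t

instance (t : Index) : Decidable t.Pos := by
  unfold Index.Pos
  infer_instance

instance : ∀ t : Index, Decidable t.Admissible
  | [] => isTrue trivial
  | p :: t => inferInstanceAs (Decidable ((2 ≤ p.1 ∨ p = (1, true)) ∧ Index.Pos t))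

theorem summable_term_mul_nestedSum {p : ℕ × Bool} (hp : 2 ≤ p.1) {t : Index} (ht : t.Pos) :
    Summable fun n => term p n * nestedSum t n := by
  refine Summable.of_norm_bounded (summable_sqrt_div_sq.mul_left (2 ^ t.length)) fun n => ?_
  refine (abs_term_mul_nestedSum_le hp ht n).trans (le_of_eq ?_)
  ring

theorem sqrt_div_tendsto_zero :
    Tendsto (fun n : ℕ => √((n : ℝ) + 1) / ((n : ℝ) + 1)) atTop (𝓝 0) := by
  have h : Tendsto (fun n : ℕ => √((n : ℝ) + 1)) atTop atTop :=
    Real.tendsto_sqrt_atTop.comp (tendsto_atTop_add_const_right _ _ tendsto_natCast_atTop_atTop)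
  refine h.inv_tendsto_atTop.congr fun n => ?_
  simp [Real.sqrt_div_self']

theorem abs_sub_nestedSum_succ_le {t : Index} (ht : t.Pos) (n : ℕ) :
    |nestedSum t (n + 1) - nestedSum t n| ≤ 2 ^ t.length * √((n : ℝ) + 1) / (n + 1) := by
  cases t with
  | nil => simp [nestedSum_nil]; positivity
  | cons p t =>
    have htt : Index.Pos t := fun q hq => ht q (List.mem_cons_of_mem _ hq)
    rw [nestedSum_cons_succ, add_sub_cancel_left]
    refine (abs_term_mul_nestedSum_le (ht p List.mem_cons_self) htt n).trans ?_
    rw [pow_one, List.length_cons, pow_succ, one_div, inv_mul_eq_div]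
    have : (0 : ℝ) < 2 ^ t.length := by positivity
    gcongr
    linarith

theorem exists_tendsto_nestedSum_alternating {t : Index} (ht : t.Pos) :
    ∃ l, Tendsto (nestedSum ((1, true) :: t)) atTop (𝓝 l) := by
  -- The minus sign reconciles `(-1) ^ (n + 1)` in `term` with `(-1) ^ n` in
  -- `exists_tendsto_sum_alternating`.
  have hA : Tendsto (fun n : ℕ => -(nestedSum t n / ((n : ℝ) + 1))) atTop (𝓝 0) := by
    refine squeeze_zero_norm (fun n => ?_) (by
      simpa using sqrt_div_tendsto_zero.const_mul (2 ^ t.length : ℝ))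
    rw [norm_neg, Real.norm_eq_abs, abs_div, abs_of_pos (by positivity : (0 : ℝ) < n + 1),
      ← mul_div_assoc]
    gcongr
    exact abs_nestedSum_le ht n
  have hv : Summable fun n : ℕ => |-(nestedSum t n / ((n : ℝ) + 1)) -
      -(nestedSum t (n + 1) / (((n + 1 : ℕ) : ℝ) + 1))| := by
    refine Summable.of_nonneg_of_le (fun _ => abs_nonneg _) (fun n => ?_)
      (summable_sqrt_div_sq.mul_left (2 * 2 ^ t.length))
    have h0 : (0 : ℝ) < n + 1 := by positivity
    -- Discrete product rule: one part carries the increment of the inner sum, the other the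
    -- increment of `1 / (n + 1)`. Both are of order `√(n + 1) / (n + 1) ^ 2`.
    have e : -(nestedSum t n / ((n : ℝ) + 1)) - -(nestedSum t (n + 1) / (((n + 1 : ℕ) : ℝ) + 1)) =
        (nestedSum t (n + 1) - nestedSum t n) / (n + 1 + 1) -
          nestedSum t n / ((n + 1) * (n + 1 + 1)) := by
      push_cast
      field_simp
      ring
    rw [e]
    refine (abs_sub _ _).trans ?_
    rw [abs_div, abs_div, abs_of_pos (by positivity : (0 : ℝ) < n + 1 + 1),
      abs_of_pos (by positivity : (0 : ℝ) < (n + 1) * (n + 1 + 1))]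
    have h1 : |nestedSum t (n + 1) - nestedSum t n| / ((n : ℝ) + 1 + 1) ≤
        2 ^ t.length * √((n : ℝ) + 1) / (n + 1) / (n + 1) :=
      div_le_div₀ (by positivity) (abs_sub_nestedSum_succ_le ht n) h0 (by linarith)
    have h2 : |nestedSum t n| / (((n : ℝ) + 1) * (n + 1 + 1)) ≤
        2 ^ t.length * √((n : ℝ) + 1) / ((n + 1) * (n + 1)) := by
      refine div_le_div₀ (by positivity) (abs_nestedSum_le ht n) (by positivity) ?_
      gcongr
      linarith
    refine (add_le_add h1 h2).trans (le_of_eq ?_)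
    field_simp
    ring
  obtain ⟨l, hl⟩ := exists_tendsto_sum_alternating hA hv
  refine ⟨l, hl.congr fun N => ?_⟩
  rw [nestedSum_cons]
  refine Finset.sum_congr rfl fun n _ => ?_
  simp only [term, if_true, pow_succ]
  ring

theorem exists_tendsto_nestedSum {t : Index} (ht : t.Admissible) :
    ∃ l, Tendsto (nestedSum t) atTop (𝓝 l) := by
  match t, ht with
  | [], _ => exact ⟨1, tendsto_const_nhds⟩
  | p :: t, ht =>
    rcases ht.1 with hp | rfl
    · exact ⟨_, (summable_term_mul_nestedSum hp ht.2).hasSum.tendsto_sum_nat⟩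
    · exact exists_tendsto_nestedSum_alternating ht.2

/-- The alternating multiple zeta value: the limit of the multiple harmonic sums. -/
def value (t : Index) : ℝ := limUnder atTop (nestedSum t)

theorem tendsto_nestedSum {t : Index} (ht : t.Admissible) :
    Tendsto (nestedSum t) atTop (𝓝 (value t)) :=
  tendsto_nhds_limUnder (exists_tendsto_nestedSum ht)

/-! ### Iterated integrals as formal power series -/

/-- The operator `x d/dx` on power series. -/
def euler (g : PowerSeries ℝ) : PowerSeries ℝ := PowerSeries.mk fun n => n * PowerSeries.coeff n g

theorem coeff_euler (n : ℕ) (g : PowerSeries ℝ) :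
    PowerSeries.coeff n (euler g) = n * PowerSeries.coeff n g := PowerSeries.coeff_mk _ _

theorem euler_mul (g h : PowerSeries ℝ) : euler (g * h) = euler g * h + g * euler h := by
  ext n
  rw [coeff_euler, map_add, PowerSeries.coeff_mul, PowerSeries.coeff_mul, PowerSeries.coeff_mul,
    Finset.mul_sum, ← Finset.sum_add_distrib]
  refine Finset.sum_congr rfl fun p hp => ?_
  rw [coeff_euler, coeff_euler, ← Finset.HasAntidiagonal.mem_antidiagonal.1 hp]
  push_cast
  ring

theorem euler_add (g h : PowerSeries ℝ) : euler (g + h) = euler g + euler h := by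
  ext n
  simp only [coeff_euler, map_add]
  ring

/-- The operator `x d/dx` kills only constants, so identities can be proved by differentiating and
comparing constant terms. -/
theorem euler_injective {g h : PowerSeries ℝ} (h0 : PowerSeries.coeff 0 g = PowerSeries.coeff 0 h)
    (he : euler g = euler h) : g = h := by
  ext n
  rcases Nat.eq_zero_or_pos n with rfl | hn
  · exact h0
  · have := congrArg (PowerSeries.coeff n) he
    rw [coeff_euler, coeff_euler] at this
    exact mul_left_cancel₀ (by positivity) this

/-- The power series of `x ω / dx` for the form `ω` attached to a letter. -/
def formSeries : Letter → PowerSeries ℝ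
  | .a => 1
  | .b => PowerSeries.mk fun n => if n = 0 then 0 else (-1) ^ (n + 1)
  | .c => PowerSeries.mk fun n => if n = 0 then 0 else 1

/-- The power series at the origin of the iterated integral along a word. -/
def wordSeries : List Letter → PowerSeries ℝ
  | [] => 1
  | l :: w => PowerSeries.mk fun n => PowerSeries.coeff n (formSeries l * wordSeries w) / n

theorem coeff_wordSeries_cons (l : Letter) (w : List Letter) (n : ℕ) :
    PowerSeries.coeff n (wordSeries (l :: w)) =
      PowerSeries.coeff n (formSeries l * wordSeries w) / n := PowerSeries.coeff_mk _ _

/-- At `n = 0` the division by zero returns zero, which is the right value for an integral starting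
at the origin. -/
theorem coeff_zero_wordSeries_cons (l : Letter) (w : List Letter) :
    PowerSeries.coeff 0 (wordSeries (l :: w)) = 0 := by
  simp [coeff_wordSeries_cons]

/-- A word does not end in the form `dx / x`. -/
def Regular : List Letter → Prop
  | [] => True
  | l :: w => (w = [] → l ≠ .a) ∧ Regular w

instance : ∀ w : List Letter, Decidable (Regular w)
  | [] => isTrue trivial
  | l :: w =>
    haveI : Decidable (Regular w) := instDecidableRegular w
    inferInstanceAs (Decidable ((w = [] → l ≠ .a) ∧ Regular w))

/-- The excluded word `[.a]` is the divergent integral of `dx / x`, the one case where the product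
on the right has a nonzero constant term. -/
theorem euler_wordSeries_cons {l : Letter} {w : List Letter} (h : w = [] → l ≠ .a) :
    euler (wordSeries (l :: w)) = formSeries l * wordSeries w := by
  ext n
  rw [coeff_euler, coeff_wordSeries_cons]
  rcases Nat.eq_zero_or_pos n with rfl | hn
  · rw [PowerSeries.coeff_mul]
    cases w with
    | cons m w => simp [coeff_zero_wordSeries_cons, -PowerSeries.coeff_zero_eq_constantCoeff]
    | nil => cases l <;> simp_all [formSeries, -PowerSeries.coeff_zero_eq_constantCoeff]
  · field_simp

theorem ne_nil_of_mem_shuffle_cons {u v w : List Letter} {m : Letter}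
    (h : w ∈ shuffle u (m :: v)) : w ≠ [] := by
  rintro rfl
  cases u with
  | nil => simp [shuffle] at h
  | cons l u => simp [shuffle_cons_cons] at h

theorem ne_nil_of_mem_cons_shuffle {u v w : List Letter} {l : Letter}
    (h : w ∈ shuffle (l :: u) v) : w ≠ [] := by
  rintro rfl
  cases v with
  | nil => simp [shuffle_nil_right] at h
  | cons m v => simp [shuffle_cons_cons] at h

theorem euler_sum_wordSeries_map_cons (l : Letter) (x : List (List Letter))
    (hx : ∀ w ∈ x, w ≠ []) :
    euler ((x.map (l :: ·)).map wordSeries).sum = formSeries l * (x.map wordSeries).sum := by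
  induction x with
  | nil => ext n; simp [coeff_euler]
  | cons w x ih =>
    simp only [List.map_cons, List.sum_cons]
    rw [euler_add, ih fun w hw => hx w (List.mem_cons_of_mem _ hw),
      euler_wordSeries_cons fun h => absurd h (hx w List.mem_cons_self), mul_add]

theorem coeff_zero_sum_wordSeries_map_cons (l : Letter) (x : List (List Letter)) :
    PowerSeries.coeff 0 ((x.map (l :: ·)).map wordSeries).sum = 0 := by
  induction x with
  | nil => simp
  | cons w x ih =>
    simp only [List.map_cons, List.sum_cons, map_add] at ih ⊢
    rw [ih, coeff_zero_wordSeries_cons, add_zero]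

/-- Iterated integrals multiply by the shuffle product. -/
theorem wordSeries_mul {u v : List Letter} (hu : Regular u) (hv : Regular v) :
    wordSeries u * wordSeries v = ((shuffle u v).map wordSeries).sum := by
  induction u generalizing v with
  | nil => simp [shuffle, wordSeries]
  | cons l u ih =>
    induction v with
    | nil => simp [shuffle_nil_right, wordSeries]
    | cons m v ihv =>
      have h1 := ih hu.2 hv
      have h2 := ihv hv.2
      rw [shuffle_cons_cons, List.map_append, List.sum_append]
      refine euler_injective ?_ ?_
      · rw [map_add, coeff_zero_sum_wordSeries_map_cons, coeff_zero_sum_wordSeries_map_cons,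
          PowerSeries.coeff_mul]
        simp [coeff_zero_wordSeries_cons, -PowerSeries.coeff_zero_eq_constantCoeff]
      -- By the Leibniz rule the derivative of the product strips the first letter of one word or of
      -- the other, as the shuffle recursion does.
      · rw [euler_add, euler_mul, euler_wordSeries_cons hu.1, euler_wordSeries_cons hv.1,
          euler_sum_wordSeries_map_cons _ _ fun w => ne_nil_of_mem_shuffle_cons,
          euler_sum_wordSeries_map_cons _ _ fun w => ne_nil_of_mem_cons_shuffle, ← h1, ← h2]
        ring

/-! ### Taylor coefficients of iterated integrals -/

/-- The last summand of `nestedSum t (n + 1)`. -/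
def headTerm : Index → ℕ → ℝ
  | [], _ => 0
  | p :: t, n => term p n * nestedSum t n

theorem nestedSum_eq_sum_headTerm {t : Index} (ht : t ≠ []) (N : ℕ) :
    nestedSum t N = ∑ n ∈ Finset.range N, headTerm t n := by
  cases t with
  | nil => exact absurd rfl ht
  | cons p t => rfl

theorem headTerm_bumpHead (t : Index) (n : ℕ) :
    headTerm (bumpHead t) n = headTerm t n / ((n : ℝ) + 1) := by
  cases t with
  | nil => simp [bumpHead, headTerm]
  | cons p t =>
    simp only [bumpHead, headTerm, term, pow_succ]
    field_simp

theorem headTerm_flipHead (t : Index) (n : ℕ) :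
    headTerm (flipHead t) n = (-1) ^ (n + 1) * headTerm t n := by
  have h : ((-1 : ℝ) ^ n) * (-1) ^ n = 1 := by
    rw [← mul_pow]; simp
  cases t with
  | nil => simp [flipHead, headTerm]
  | cons p t =>
    obtain ⟨s, e⟩ := p
    cases e
    · simp only [flipHead, headTerm, term]
      simp
      ring
    · simp only [flipHead, headTerm, term]
      simp [pow_succ]
      linear_combination (-(((n : ℝ) + 1) ^ s)⁻¹ * nestedSum t n) * h

theorem toIndex_ne_nil {w : List Letter} (hw : Regular w) (h : w ≠ []) : (toIndex w).2 ≠ [] := by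
  induction w with
  | nil => exact absurd rfl h
  | cons l w ih =>
    cases l with
    | a =>
      have hw' : w ≠ [] := fun e => hw.1 e rfl
      have := ih hw.2 hw'
      simp only [toIndex]
      cases e : (toIndex w).2 with
      | nil => exact absurd e this
      | cons p t => simp [bumpHead]
    | b => simp [toIndex]
    | c => simp [toIndex]

theorem flipHead_ne_nil {t : Index} (h : t ≠ []) : flipHead t ≠ [] := by
  cases t with
  | nil => exact absurd rfl h
  | cons p t => simp [flipHead]

/-- The Taylor coefficients of iterated integrals are summands of multiple harmonic sums. -/
theorem coeff_succ_wordSeries {w : List Letter} (hw : Regular w) (h : w ≠ []) (n : ℕ) :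
    PowerSeries.coeff (n + 1) (wordSeries w) = (toIndex w).1 * headTerm (toIndex w).2 n := by
  induction w generalizing n with
  | nil => exact absurd rfl h
  | cons l w ih =>
    rw [coeff_wordSeries_cons]
    cases l with
    | a =>
      have hw' : w ≠ [] := fun e => hw.1 e rfl
      simp only [formSeries, one_mul, toIndex]
      rw [ih hw.2 hw', headTerm_bumpHead]
      push_cast
      ring
    | b =>
      rw [mul_comm (formSeries _), PowerSeries.coeff_mul,
        Finset.Nat.sum_antidiagonal_eq_sum_range_succ_mk]
      simp only [formSeries, PowerSeries.coeff_mk, toIndex, headTerm, term]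
      -- The two end terms of the Cauchy product are split off. The last vanishes because the form
      -- has no constant coefficient; the first vanishes too unless `w` is empty, when it is the
      -- only one left.
      rw [Finset.sum_range_succ]
      by_cases hw' : w = []
      · subst hw'
        rw [Finset.sum_range_succ', Finset.sum_eq_zero fun k _ => by
          simp [wordSeries, PowerSeries.coeff_one]]
        simp [wordSeries, toIndex, flipHead, nestedSum_nil, pow_succ]
        ring
      · obtain ⟨m, w', rfl⟩ := List.exists_cons_of_ne_nil hw'
        rw [Finset.sum_range_succ', coeff_zero_wordSeries_cons,
          nestedSum_eq_sum_headTerm (flipHead_ne_nil (toIndex_ne_nil hw.2 hw'))]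
        simp only [headTerm_flipHead, Nat.sub_self, if_true, mul_zero, add_zero, zero_mul]
        push_cast
        rw [Finset.mul_sum, Finset.mul_sum, Finset.sum_div]
        refine Finset.sum_congr rfl fun k hk => ?_
        have hk' := Finset.mem_range.1 hk
        rw [ih hw.2 hw', if_neg (by omega)]
        -- The coefficient of the form is `(-1)^(n-k+1) = -(-1)^(n+1) (-1)^(k+1)`. This accounts for
        -- the sign change and for `flipHead` in `toIndex`.
        obtain ⟨d, rfl⟩ := Nat.exists_eq_add_of_lt hk'
        have e : k + d + 1 - k + 1 = d + 2 := by omega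
        have hh : ((-1 : ℝ) ^ k) * (-1) ^ k = 1 := by
          rw [← mul_pow]; simp
        rw [e]
        simp only [pow_add]
        push_cast
        field_simp
        linear_combination (-(toIndex (m :: w')).1 * headTerm (toIndex (m :: w')).2 k) * hh
    | c =>
      rw [mul_comm (formSeries _), PowerSeries.coeff_mul,
        Finset.Nat.sum_antidiagonal_eq_sum_range_succ_mk]
      simp only [formSeries, PowerSeries.coeff_mk, toIndex, headTerm, term]
      rw [Finset.sum_range_succ]
      by_cases hw' : w = []
      · subst hw'
        rw [Finset.sum_range_succ', Finset.sum_eq_zero fun k _ => by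
          simp [wordSeries, PowerSeries.coeff_one]]
        simp [wordSeries, toIndex, nestedSum_nil]
      · obtain ⟨m, w', rfl⟩ := List.exists_cons_of_ne_nil hw'
        rw [Finset.sum_range_succ', coeff_zero_wordSeries_cons,
          nestedSum_eq_sum_headTerm (toIndex_ne_nil hw.2 hw')]
        simp only [Nat.sub_self, if_true, mul_zero, add_zero, zero_mul]
        rw [Finset.mul_sum, Finset.mul_sum, Finset.sum_div]
        refine Finset.sum_congr rfl fun k hk => ?_
        have hk' := Finset.mem_range.1 hk
        rw [ih hw.2 hw', if_neg (by omega)]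
        push_cast
        simp
        ring

/-! ### Evaluation of power series on the unit interval -/

/-- The value of a power series at a real point. -/
def evalSeries (f : PowerSeries ℝ) (x : ℝ) : ℝ := ∑' n, PowerSeries.coeff n f * x ^ n

/-- The coefficients of a power series are bounded. -/
def BoundedCoeff (f : PowerSeries ℝ) : Prop := ∃ C, ∀ n, |PowerSeries.coeff n f| ≤ C

/-- A power series converges absolutely on the open unit interval. -/
def ConvergesOnUnit (f : PowerSeries ℝ) : Prop :=
  ∀ x : ℝ, |x| < 1 → Summable fun n => ‖PowerSeries.coeff n f * x ^ n‖

theorem BoundedCoeff.convergesOnUnit {f : PowerSeries ℝ} (hf : BoundedCoeff f) :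
    ConvergesOnUnit f := by
  obtain ⟨C, hC⟩ := hf
  intro x hx
  refine Summable.of_nonneg_of_le (fun _ => norm_nonneg _) (fun n => ?_)
    ((summable_geometric_of_lt_one (abs_nonneg x) hx).mul_left C)
  rw [norm_mul, norm_pow, Real.norm_eq_abs, Real.norm_eq_abs]
  gcongr
  exact hC n

theorem BoundedCoeff.add {f g : PowerSeries ℝ} (hf : BoundedCoeff f) (hg : BoundedCoeff g) :
    BoundedCoeff (f + g) := by
  obtain ⟨C, hC⟩ := hf
  obtain ⟨D, hD⟩ := hg
  refine ⟨C + D, fun n => ?_⟩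
  rw [map_add]
  exact (abs_add_le _ _).trans (add_le_add (hC n) (hD n))

theorem BoundedCoeff.smul {f : PowerSeries ℝ} (hf : BoundedCoeff f) (k : ℝ) :
    BoundedCoeff (k • f) := by
  obtain ⟨C, hC⟩ := hf
  refine ⟨|k| * C, fun n => ?_⟩
  rw [map_smul, smul_eq_mul, abs_mul]
  exact mul_le_mul_of_nonneg_left (hC n) (abs_nonneg k)

theorem evalSeries_add {f g : PowerSeries ℝ} (hf : ConvergesOnUnit f) (hg : ConvergesOnUnit g)
    {x : ℝ} (hx : |x| < 1) : evalSeries (f + g) x = evalSeries f x + evalSeries g x := by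
  rw [evalSeries, evalSeries, evalSeries, ← (hf x hx).of_norm.tsum_add (hg x hx).of_norm]
  simp only [map_add, add_mul]

theorem evalSeries_smul (k : ℝ) (f : PowerSeries ℝ) (x : ℝ) :
    evalSeries (k • f) x = k * evalSeries f x := by
  rw [evalSeries, evalSeries, ← tsum_mul_left]
  simp only [map_smul, smul_eq_mul, mul_assoc]

theorem coeff_mul_mul_pow (f g : PowerSeries ℝ) (x : ℝ) (n : ℕ) :
    PowerSeries.coeff n (f * g) * x ^ n = ∑ p ∈ Finset.HasAntidiagonal.antidiagonal n,
      (PowerSeries.coeff p.1 f * x ^ p.1) * (PowerSeries.coeff p.2 g * x ^ p.2) := by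
  rw [PowerSeries.coeff_mul, Finset.sum_mul]
  refine Finset.sum_congr rfl fun p hp => ?_
  rw [← Finset.HasAntidiagonal.mem_antidiagonal.1 hp, pow_add]
  ring

theorem ConvergesOnUnit.mul {f g : PowerSeries ℝ} (hf : ConvergesOnUnit f)
    (hg : ConvergesOnUnit g) : ConvergesOnUnit (f * g) := by
  intro x hx
  refine (summable_norm_sum_mul_antidiagonal_of_summable_norm
    (f := fun n => PowerSeries.coeff n f * x ^ n) (g := fun n => PowerSeries.coeff n g * x ^ n)
    (hf x hx) (hg x hx)).congr fun n => ?_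
  rw [coeff_mul_mul_pow]

theorem evalSeries_mul {f g : PowerSeries ℝ} (hf : ConvergesOnUnit f) (hg : ConvergesOnUnit g)
    {x : ℝ} (hx : |x| < 1) : evalSeries (f * g) x = evalSeries f x * evalSeries g x := by
  rw [evalSeries, evalSeries, evalSeries,
    tsum_mul_tsum_eq_tsum_sum_antidiagonal_of_summable_norm (hf x hx) (hg x hx)]
  simp only [coeff_mul_mul_pow]

theorem evalSeries_zero_right (f : PowerSeries ℝ) :
    evalSeries f 0 = PowerSeries.coeff 0 f := by
  rw [evalSeries, tsum_eq_single 0 fun n hn => by simp [hn]]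
  simp

/-- Termwise differentiation on a ball of radius `r` with `|x| < r < 1`, where the derivatives are
dominated by `C n r^(n-1)`. -/
theorem BoundedCoeff.hasDerivAt {f : PowerSeries ℝ} (hf : BoundedCoeff f) {x : ℝ} (hx : |x| < 1) :
    HasDerivAt (evalSeries f) (∑' n : ℕ, PowerSeries.coeff n f * (n * x ^ (n - 1))) x := by
  obtain ⟨C, hC⟩ := hf
  obtain ⟨r, hxr, hr⟩ := exists_between hx
  have hr0 : 0 ≤ r := (abs_nonneg x).trans hxr.le
  have hC0 : 0 ≤ C := (abs_nonneg _).trans (hC 0)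
  have hu : Summable fun n : ℕ => C * (n * r ^ (n - 1)) := by
    refine Summable.mul_left C ?_
    refine (summable_nat_add_iff 1).1 ?_
    have h1 : Summable fun n : ℕ => (n : ℝ) ^ 1 * r ^ n :=
      summable_pow_mul_geometric_of_norm_lt_one 1 (by rwa [Real.norm_of_nonneg hr0])
    refine (h1.add (summable_geometric_of_lt_one hr0 hr)).congr fun n => ?_
    push_cast
    ring
  refine hasDerivAt_tsum_of_isPreconnected (t := Metric.ball 0 r) (y₀ := 0) hu Metric.isOpen_ball
    (convex_ball (0 : ℝ) r).isPreconnected (fun n y _ => (hasDerivAt_pow n y).const_mul _)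
    (fun n y hy => ?_) (Metric.mem_ball_self ((abs_nonneg x).trans_lt hxr)) ?_
    (by simpa using hxr)
  · rw [norm_mul, norm_mul, norm_pow, Real.norm_natCast, Real.norm_eq_abs, Real.norm_eq_abs]
    have hy' : |y| ≤ r := by simpa using (Metric.mem_ball.1 hy).le
    exact mul_le_mul (hC n) (by gcongr) (by positivity) hC0
  · exact (BoundedCoeff.convergesOnUnit ⟨C, hC⟩ 0 (by simp)).of_norm

theorem BoundedCoeff.hasDerivAt_euler {f : PowerSeries ℝ} (hf : BoundedCoeff f) {x : ℝ}
    (hx : |x| < 1) (hx0 : x ≠ 0) : HasDerivAt (evalSeries f) (evalSeries (euler f) x / x) x := by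
  convert hf.hasDerivAt hx using 1
  rw [evalSeries, ← tsum_div_const]
  refine tsum_congr fun n => ?_
  rw [coeff_euler]
  cases n with
  | zero => simp
  | succ n =>
    rw [Nat.add_sub_cancel, pow_succ]
    field_simp

theorem abs_coeff_formSeries_le (l : Letter) (n : ℕ) :
    |PowerSeries.coeff n (formSeries l)| ≤ 1 := by
  cases l <;> simp only [formSeries, PowerSeries.coeff_mk, PowerSeries.coeff_one] <;>
    split_ifs <;> simp

/-- Each letter costs a factor `2`: the Cauchy product has `n + 1` terms and is divided by `n`. -/
theorem abs_coeff_wordSeries_le (w : List Letter) (n : ℕ) :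
    |PowerSeries.coeff n (wordSeries w)| ≤ 2 ^ w.length := by
  induction w generalizing n with
  | nil =>
    simp only [wordSeries, PowerSeries.coeff_one]
    split_ifs <;> simp
  | cons l w ih =>
    rcases Nat.eq_zero_or_pos n with rfl | hn
    · rw [coeff_zero_wordSeries_cons, abs_zero]; positivity
    · have hn' : (1 : ℝ) ≤ n := by exact_mod_cast hn
      rw [coeff_wordSeries_cons, abs_div, Nat.abs_cast, div_le_iff₀ (by positivity),
        PowerSeries.coeff_mul]
      calc |∑ p ∈ Finset.HasAntidiagonal.antidiagonal n, PowerSeries.coeff p.1 (formSeries l) *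
              PowerSeries.coeff p.2 (wordSeries w)|
          ≤ ∑ p ∈ Finset.HasAntidiagonal.antidiagonal n, |PowerSeries.coeff p.1 (formSeries l) *
              PowerSeries.coeff p.2 (wordSeries w)| := Finset.abs_sum_le_sum_abs _ _
        _ ≤ ∑ _p ∈ Finset.HasAntidiagonal.antidiagonal n, 2 ^ w.length := by
            refine Finset.sum_le_sum fun p _ => ?_
            rw [abs_mul, ← one_mul ((2 : ℝ) ^ w.length)]
            exact mul_le_mul (abs_coeff_formSeries_le l _) (ih _) (abs_nonneg _) zero_le_one
        _ = (n + 1) * 2 ^ w.length := by simp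
        _ ≤ 2 ^ (l :: w).length * n := by
            rw [List.length_cons, pow_succ]
            nlinarith [pow_pos (zero_lt_two : (0 : ℝ) < 2) w.length]

theorem boundedCoeff_wordSeries (w : List Letter) : BoundedCoeff (wordSeries w) :=
  ⟨_, abs_coeff_wordSeries_le w⟩

theorem boundedCoeff_formSeries (l : Letter) : BoundedCoeff (formSeries l) :=
  ⟨_, abs_coeff_formSeries_le l⟩

/-! ### Boundary values at `1` and the shuffle relation -/

/-- The words whose iterated integrals over the unit interval are shown to converge. -/
def Convergent (w : List Letter) : Prop := w ≠ [] ∧ Regular w ∧ (toIndex w).2.Admissible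

instance (w : List Letter) : Decidable (Convergent w) := by
  unfold Convergent
  infer_instance

/-- The value at `1` of an iterated integral, by Abel's theorem. -/
theorem tendsto_evalSeries_wordSeries {w : List Letter} (hw : Convergent w) :
    Tendsto (evalSeries (wordSeries w)) (𝓝[<] 1)
      (𝓝 ((toIndex w).1 * value (toIndex w).2)) := by
  refine Real.tendsto_tsum_powerSeries_nhdsWithin_lt ?_
  -- The constant term is zero and the coefficient of `x^(n+1)` is the head term at `n`, so `N + 1`
  -- coefficients add up to the nested sum at `N`.
  rw [← tendsto_add_atTop_iff_nat 1]
  refine ((tendsto_nestedSum hw.2.2).const_mul _).congr fun N => ?_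
  obtain ⟨l, w', rfl⟩ := List.exists_cons_of_ne_nil hw.1
  rw [Finset.sum_range_succ', coeff_zero_wordSeries_cons, add_zero,
    nestedSum_eq_sum_headTerm (toIndex_ne_nil hw.2.1 hw.1), Finset.mul_sum]
  exact Finset.sum_congr rfl fun n _ => (coeff_succ_wordSeries hw.2.1 hw.1 n).symm

theorem eventually_abs_lt_one : ∀ᶠ x : ℝ in 𝓝[<] 1, |x| < 1 := by
  filter_upwards [Ioo_mem_nhdsLT (zero_lt_one : (0 : ℝ) < 1)] with x hx
  rw [abs_of_pos hx.1]
  exact hx.2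

/-- The combination of word series attached to a formal combination of words. -/
def combinationSeries (x : List (ℤ × List Letter)) : PowerSeries ℝ :=
  (x.map fun p => (p.1 : ℝ) • wordSeries p.2).sum

theorem combinationSeries_cons (p : ℤ × List Letter) (x : List (ℤ × List Letter)) :
    combinationSeries (p :: x) = (p.1 : ℝ) • wordSeries p.2 + combinationSeries x := rfl

theorem combinationSeries_append (x y : List (ℤ × List Letter)) :
    combinationSeries (x ++ y) = combinationSeries x + combinationSeries y := by
  simp [combinationSeries]

theorem boundedCoeff_combinationSeries (x : List (ℤ × List Letter)) :
    BoundedCoeff (combinationSeries x) := by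
  induction x with
  | nil => exact ⟨0, fun n => by simp [combinationSeries]⟩
  | cons p x ih => exact ((boundedCoeff_wordSeries p.2).smul _).add ih

/-- The limit of a formal combination of multiple harmonic sums. -/
def Lin.value (x : Lin) : ℝ := (x.map fun p => (p.1 : ℝ) * SkewHarmonicSeries.value p.2).sum

theorem Lin.tendsto_evalAt {x : Lin} (hx : ∀ p ∈ x, p.2.Admissible) :
    Tendsto x.evalAt atTop (𝓝 x.value) := by
  induction x with
  | nil => exact tendsto_const_nhds
  | cons p x ih =>
    exact ((tendsto_nestedSum (hx p List.mem_cons_self)).const_mul _).add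
      (ih fun q hq => hx q (List.mem_cons_of_mem _ hq))

theorem tendsto_evalSeries_combinationSeries {x : List (ℤ × List Letter)}
    (hx : ∀ p ∈ x, Convergent p.2) :
    Tendsto (evalSeries (combinationSeries x)) (𝓝[<] 1) (𝓝 (wordsToLin x).value) := by
  induction x with
  | nil =>
    refine tendsto_const_nhds.congr fun z => ?_
    simp [combinationSeries, evalSeries, wordsToLin, Lin.value]
  | cons p x ih =>
    have h := ((tendsto_evalSeries_wordSeries (hx p List.mem_cons_self)).const_mul (p.1 : ℝ)).add
      (ih fun q hq => hx q (List.mem_cons_of_mem _ hq))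
    have e : (p.1 : ℝ) * ((toIndex p.2).1 * value (toIndex p.2).2) + (wordsToLin x).value =
        (wordsToLin (p :: x)).value := by
      simp [wordsToLin, Lin.value, mul_assoc]
    rw [e] at h
    refine h.congr' ?_
    filter_upwards [eventually_abs_lt_one] with z hz
    rw [combinationSeries_cons,
      evalSeries_add ((boundedCoeff_wordSeries p.2).smul _).convergesOnUnit
      (boundedCoeff_combinationSeries x).convergesOnUnit hz, evalSeries_smul]

/-- The shuffle product formula for alternating multiple zeta values. -/
theorem value_mul_value_eq_shuffle {u v : List Letter} (hu : Convergent u) (hv : Convergent v)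
    (h : ∀ w ∈ shuffle u v, Convergent w) :
    ((toIndex u).1 * value (toIndex u).2) * ((toIndex v).1 * value (toIndex v).2) =
      (wordsToLin ((shuffle u v).map fun w => (1, w))).value := by
  have h1 := (tendsto_evalSeries_wordSeries hu).mul (tendsto_evalSeries_wordSeries hv)
  have h2 := tendsto_evalSeries_combinationSeries (x := (shuffle u v).map fun w => (1, w))
    (by simpa using h)
  refine tendsto_nhds_unique (h1.congr' ?_) h2
  filter_upwards [eventually_abs_lt_one] with z hz
  rw [← evalSeries_mul (boundedCoeff_wordSeries u).convergesOnUnit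
    (boundedCoeff_wordSeries v).convergesOnUnit hz, wordSeries_mul hu.2.1 hv.2.1]
  simp [combinationSeries, Function.comp_def]

/-! ### Polylogarithms at one half -/

/-- The power series of the polylogarithm of order `s`. -/
def polylogSeries (s : ℕ) : PowerSeries ℝ :=
  PowerSeries.mk fun n => if n = 0 then 0 else 1 / (n : ℝ) ^ s

theorem boundedCoeff_polylogSeries (s : ℕ) : BoundedCoeff (polylogSeries s) := by
  refine ⟨1, fun n => ?_⟩
  rw [polylogSeries, PowerSeries.coeff_mk]
  split_ifs with h
  · simp
  · have h1 : (1 : ℝ) ≤ n := by exact_mod_cast Nat.one_le_iff_ne_zero.2 h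
    rw [abs_of_nonneg (by positivity)]
    exact div_le_one_of_le₀ (one_le_pow₀ h1) (by positivity)

theorem euler_polylogSeries (s : ℕ) : euler (polylogSeries (s + 1)) = polylogSeries s := by
  ext n
  rw [coeff_euler, polylogSeries, polylogSeries, PowerSeries.coeff_mk, PowerSeries.coeff_mk]
  split_ifs with h
  · simp
  · have : (n : ℝ) ≠ 0 := by exact_mod_cast h
    rw [pow_succ]
    field_simp

theorem evalSeries_polylogSeries (s : ℕ) {x : ℝ} (hx : |x| < 1) :
    evalSeries (polylogSeries s) x = polylog s x := by
  rw [evalSeries, ((boundedCoeff_polylogSeries s).convergesOnUnit x hx).of_norm.tsum_eq_zero_add,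
    polylog]
  simp only [polylogSeries, PowerSeries.coeff_mk, if_true, zero_mul, zero_add]
  refine tsum_congr fun n => ?_
  rw [if_neg n.succ_ne_zero]
  push_cast
  ring

theorem evalSeries_polylogSeries_zero {x : ℝ} (hx : |x| < 1) :
    evalSeries (polylogSeries 0) x = x / (1 - x) := by
  rw [evalSeries_polylogSeries 0 hx, polylog, div_eq_mul_inv, ← tsum_geometric_of_norm_lt_one hx,
    ← tsum_mul_left]
  refine tsum_congr fun n => ?_
  rw [pow_zero, div_one, pow_succ]
  ring

theorem abs_div_one_add_lt {x : ℝ} (hx : 0 ≤ x) : |x / (1 + x)| < 1 := by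
  rw [abs_of_nonneg (by positivity), div_lt_one (by positivity)]
  linarith

/-- A primitive characterization of `Li_{s + 1} (x / (1 + x))`. -/
theorem eq_polylogSeries_of_hasDerivAt {f : PowerSeries ℝ} (hf : BoundedCoeff f)
    (h0 : PowerSeries.coeff 0 f = 0) (s : ℕ)
    (h : ∀ x : ℝ, 0 < x → x < 1 →
      evalSeries (euler f) x = evalSeries (polylogSeries s) (x / (1 + x)) / (1 + x))
    {x : ℝ} (hx0 : 0 ≤ x) (hx1 : x < 1) :
    evalSeries f x = evalSeries (polylogSeries (s + 1)) (x / (1 + x)) := by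
  rcases hx0.eq_or_lt with rfl | hx0
  · rw [zero_div, evalSeries_zero_right, evalSeries_zero_right, h0]
    simp [polylogSeries, -PowerSeries.coeff_zero_eq_constantCoeff]
  have hy (y : ℝ) (hy : 0 ≤ y) : HasDerivAt (fun z : ℝ => z / (1 + z)) (1 / (1 + y) ^ 2) y := by
    have hne : 1 + y ≠ 0 := by positivity
    exact ((hasDerivAt_id' y).fun_div ((hasDerivAt_id' y).const_add 1) hne).congr_deriv (by ring)
  have hP (y : ℝ) (hy0 : 0 ≤ y) :=
    ((boundedCoeff_polylogSeries (s + 1)).hasDerivAt (abs_div_one_add_lt hy0))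
  set D : ℝ → ℝ := fun y =>
    evalSeries f y - evalSeries (polylogSeries (s + 1)) (y / (1 + y)) with hD
  have hlt {y : ℝ} (h1 : 0 ≤ y) (h2 : y ≤ x) : |y| < 1 := by
    rw [abs_of_nonneg h1]; linarith
  -- Mean value theorem on `[0, x]`: the derivative of `D` vanishes inside and `D 0 = 0`. The
  -- endpoint `0` is kept out because `hasDerivAt_euler` divides by the point.
  obtain ⟨c, hc, hslope⟩ := exists_hasDerivAt_eq_slope D (fun _ => 0) hx0
    (fun y hy' => ContinuousAt.continuousWithinAt <|
      ((hf.hasDerivAt (hlt hy'.1 hy'.2)).continuousAt).sub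
        (ContinuousAt.comp (f := fun z : ℝ => z / (1 + z)) (hP y hy'.1).continuousAt
          (hy y hy'.1).continuousAt))
    (fun y hy' => by
      have hy0 : 0 < y := hy'.1
      have hq : y / (1 + y) ≠ 0 := by positivity
      have d1 := hf.hasDerivAt_euler (hlt hy'.1.le hy'.2.le) hy0.ne'
      have d2 := ((boundedCoeff_polylogSeries (s + 1)).hasDerivAt_euler
        (abs_div_one_add_lt hy0.le) hq).comp y (hy y hy0.le)
      refine (d1.sub d2).congr_deriv ?_
      rw [h y hy0 (hy'.2.trans hx1), euler_polylogSeries]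
      field_simp
      ring)
  have hD0 : D 0 = 0 := by
    simp only [hD]
    rw [zero_div, evalSeries_zero_right, evalSeries_zero_right, h0]
    simp [polylogSeries, -PowerSeries.coeff_zero_eq_constantCoeff]
  rw [hD0, eq_div_iff (by linarith)] at hslope
  simp only [hD] at hslope
  linarith

theorem evalSeries_formSeries_b {x : ℝ} (hx : |x| < 1) :
    evalSeries (formSeries .b) x = x / (1 + x) := by
  have hx' : ‖-x‖ < 1 := by simpa using hx
  rw [evalSeries, ((boundedCoeff_formSeries .b).convergesOnUnit x hx).of_norm.tsum_eq_zero_add]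
  have e : x / (1 + x) = x * (1 - -x)⁻¹ := by rw [sub_neg_eq_add, div_eq_mul_inv]
  rw [e, ← tsum_geometric_of_norm_lt_one hx', ← tsum_mul_left]
  simp only [formSeries, PowerSeries.coeff_mk, if_true, zero_mul, zero_add]
  refine tsum_congr fun n => ?_
  rw [if_neg n.succ_ne_zero, neg_pow x n]
  ring

theorem coeff_zero_combinationSeries {x : List (ℤ × List Letter)} (hx : ∀ p ∈ x, p.2 ≠ []) :
    PowerSeries.coeff 0 (combinationSeries x) = 0 := by
  induction x with
  | nil => simp [combinationSeries]
  | cons p x ih =>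
    obtain ⟨l, w, hw⟩ := List.exists_cons_of_ne_nil (hx p List.mem_cons_self)
    rw [combinationSeries_cons, map_add, ih fun q hq => hx q (List.mem_cons_of_mem _ hq), hw,
      map_smul, coeff_zero_wordSeries_cons, smul_zero, add_zero]

theorem euler_smul (k : ℝ) (g : PowerSeries ℝ) : euler (k • g) = k • euler g := by
  ext n
  simp only [coeff_euler, map_smul, smul_eq_mul]
  ring

theorem euler_combinationSeries_map_cons (l : Letter) (ε : ℤ) {x : List (ℤ × List Letter)}
    (hx : ∀ p ∈ x, p.2 ≠ []) :
    euler (combinationSeries (x.map fun p => (ε * p.1, l :: p.2))) =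
      (ε : ℝ) • (formSeries l * combinationSeries x) := by
  induction x with
  | nil => ext n; simp [combinationSeries, coeff_euler]
  | cons p x ih =>
    rw [List.map_cons, combinationSeries_cons, euler_add, euler_smul,
      euler_wordSeries_cons fun h => absurd h (hx p List.mem_cons_self),
      ih fun q hq => hx q (List.mem_cons_of_mem _ hq), combinationSeries_cons, mul_add, smul_add,
      mul_smul_comm, smul_smul]
    push_cast
    rfl

theorem polylogWords_ne_nil (s : ℕ) : ∀ p ∈ polylogWords s, p.2 ≠ [] := by
  match s with
  | 0 => simp [polylogWords]
  | 1 => simp [polylogWords]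
  | s + 2 =>
    intro p hp
    rw [polylogWords, List.mem_append, List.mem_map, List.mem_map] at hp
    rcases hp with ⟨q, _, rfl⟩ | ⟨q, _, rfl⟩ <;> simp

/-- Under `y = x / (1 + x)` the form `dy/y` becomes `dx/x - dx/(1+x)` and `dy/(1-y)` becomes
`dx/(1+x)`. Hence the words are the expansion of `(a - b)^s b`; at `x = 1` the argument is `1/2`. -/
theorem evalSeries_polylogWords (s : ℕ) {x : ℝ} (hx0 : 0 ≤ x) (hx1 : x < 1) :
    evalSeries (combinationSeries (polylogWords (s + 1))) x =
      evalSeries (polylogSeries (s + 1)) (x / (1 + x)) := by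
  induction s generalizing x with
  | zero =>
    refine eq_polylogSeries_of_hasDerivAt (boundedCoeff_combinationSeries _)
      (coeff_zero_combinationSeries (polylogWords_ne_nil 1)) 0 (fun y hy0 hy1 => ?_) hx0 hx1
    have hy : |y| < 1 := by rwa [abs_of_pos hy0]
    have e : combinationSeries (polylogWords (0 + 1)) = wordSeries [.b] := by
      simp [combinationSeries, polylogWords]
    rw [e, euler_wordSeries_cons (by simp), wordSeries, mul_one, evalSeries_formSeries_b hy,
      evalSeries_polylogSeries_zero (abs_div_one_add_lt hy0.le)]
    field_simp
    ring
  | succ s ih =>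
    refine eq_polylogSeries_of_hasDerivAt (boundedCoeff_combinationSeries _)
      (coeff_zero_combinationSeries (polylogWords_ne_nil _)) (s + 1) (fun y hy0 hy1 => ?_) hx0 hx1
    have hy : |y| < 1 := by rwa [abs_of_pos hy0]
    have hne := polylogWords_ne_nil (s + 1)
    have e1 := euler_combinationSeries_map_cons .a 1 hne
    have e2 := euler_combinationSeries_map_cons .b (-1) hne
    simp only [one_mul, neg_mul] at e1 e2
    have hc := (boundedCoeff_combinationSeries (polylogWords (s + 1))).convergesOnUnit
    have hb := (boundedCoeff_formSeries .b).convergesOnUnit.mul hc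
    rw [polylogWords, combinationSeries_append, euler_add, e1, e2, ← ih hy0.le hy1]
    have hb' : ConvergesOnUnit (((-1 : ℤ) : ℝ) • (formSeries .b *
        combinationSeries (polylogWords (s + 1)))) := by
      intro z hz
      simpa using hb z hz
    simp only [formSeries, one_mul, Int.cast_one, one_smul] at hb' ⊢
    rw [evalSeries_add hc hb' hy, evalSeries_smul]
    change _ + _ * evalSeries (formSeries .b * _) y = _
    rw [evalSeries_mul (boundedCoeff_formSeries .b).convergesOnUnit hc hy,
      evalSeries_formSeries_b hy]
    push_cast
    field_simp
    ring

/-- Polylogarithms at one half as combinations of alternating multiple zeta values. -/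
theorem polylogLin_value {s : ℕ} (h : ∀ p ∈ polylogWords (s + 1), Convergent p.2) :
    (polylogLin (s + 1)).value = polylog (s + 1) (1 / 2) := by
  have h1 := tendsto_evalSeries_combinationSeries h
  have h2 : Tendsto (fun x : ℝ => evalSeries (polylogSeries (s + 1)) (x / (1 + x))) (𝓝[<] 1)
      (𝓝 (evalSeries (polylogSeries (s + 1)) (1 / 2))) := by
    refine Tendsto.mono_left ?_ nhdsWithin_le_nhds
    have hc : ContinuousAt (fun x : ℝ => x / (1 + x)) 1 :=
      continuousAt_id.div (continuousAt_const.add continuousAt_id) (by norm_num)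
    have hd := ((boundedCoeff_polylogSeries (s + 1)).hasDerivAt
      (abs_div_one_add_lt zero_le_one)).continuousAt
    have := ContinuousAt.comp (f := fun x : ℝ => x / (1 + x)) hd hc
    simpa [ContinuousAt, Function.comp_def, one_add_one_eq_two] using this
  rw [← evalSeries_polylogSeries _ (by rw [abs_of_pos] <;> norm_num)]
  refine tendsto_nhds_unique (h1.congr' ?_) h2
  filter_upwards [Ioo_mem_nhdsLT (zero_lt_one : (0 : ℝ) < 1)] with x hx
  exact evalSeries_polylogWords s hx.1.le hx.2

/-! ### The constants as alternating multiple zeta values -/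

theorem logTwoLin_value : logTwoLin.value = Real.log 2 := by
  have h1 : logTwoLin.value = (polylogLin 1).value := by
    simp [logTwoLin, polylogLin, polylogWords, wordsToLin, toIndex, flipHead, Lin.value]
  have h2 := Real.hasSum_pow_div_log_of_abs_lt_one (x := 1 / 2) (by rw [abs_of_pos] <;> norm_num)
  rw [h1, polylogLin_value (by decide), polylog]
  simp only [zero_add, pow_one]
  rw [h2.tsum_eq, ← Real.log_inv]
  norm_num

theorem zetaLin_value {s : ℕ} (hs : 2 ≤ s) : (zetaLin s).value = zeta s := by
  have hz : zeta s = ∑' n : ℕ, 1 / (n : ℝ) ^ s := by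
    apply Complex.ofReal_injective
    rw [ofReal_zeta s hs, zeta_nat_eq_tsum_of_gt_one hs]
    push_cast
    rfl
  have hsum : Summable fun n : ℕ => 1 / (n : ℝ) ^ s := Real.summable_one_div_nat_pow.2 hs
  have e : (zetaLin s).value = value [(s, false)] := by simp [zetaLin, Lin.value]
  have ha : Index.Admissible [(s, false)] := ⟨Or.inl hs, by simp [Index.Pos]⟩
  rw [e, hz, hsum.tsum_eq_zero_add]
  refine tendsto_nhds_unique (tendsto_nestedSum ha) ?_
  have := ((summable_nat_add_iff 1).2 hsum).hasSum.tendsto_sum_nat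
  rw [Nat.cast_zero, zero_pow (by omega), div_zero, zero_add]
  refine this.congr fun N => ?_
  simp [nestedSum, term]

/-- The relation between the zeta values and their alternating companions. -/
theorem eta_relation {s : ℕ} (hs : 2 ≤ s) :
    2 ^ (s - 1) * (value [(s, false)] + value [(s, true)]) = value [(s, false)] := by
  have ha (e : Bool) : Index.Admissible [(s, e)] := ⟨Or.inl hs, by simp [Index.Pos]⟩
  have h1 : Tendsto (fun N : ℕ => 2 * N) atTop atTop :=
    tendsto_id.const_mul_atTop' (by norm_num)
  have h2 := (((tendsto_nestedSum (ha false)).add (tendsto_nestedSum (ha true))).comp h1).const_mul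
    (2 ^ (s - 1) : ℝ)
  refine tendsto_nhds_unique (h2.congr fun N => ?_) (tendsto_nestedSum (ha false))
  obtain ⟨k, rfl⟩ : ∃ k, s = k + 1 := ⟨s - 1, by omega⟩
  simp only [Function.comp_apply, Nat.add_sub_cancel]
  -- Up to `2 * N` the odd denominators cancel and the even ones count twice, so the identity
  -- between the truncations at `2 * N` and `N` is exact.
  induction N with
  | zero => simp [nestedSum_cons_zero]
  | succ N ih =>
    rw [show 2 * (N + 1) = 2 * N + 1 + 1 by ring]
    simp only [nestedSum_cons_succ _ _ (2 * N + 1), nestedSum_cons_succ _ _ (2 * N),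
      nestedSum_cons_succ _ _ N, nestedSum_nil, mul_one]
    rw [← ih]
    have e : (((2 * N + 1 : ℕ) : ℝ) + 1) = 2 * (N + 1) := by push_cast; ring
    simp only [term, e, mul_pow]
    have o1 : (-1 : ℝ) ^ (2 * N + 1) = -1 := by rw [pow_succ, pow_mul]; simp
    have o2 : (-1 : ℝ) ^ (2 * N + 1 + 1) = 1 := by rw [pow_succ, o1]; simp
    simp only [o1, o2, if_true, if_false, Bool.false_eq_true]
    have : ((N : ℝ) + 1) ^ (k + 1) ≠ 0 := by positivity
    rw [pow_succ 2 k]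
    field_simp
    ring

/-! ### Passing to the limit in the certificate -/

/-- The side conditions under which a relation holds. -/
def Relation.Valid : Relation → Prop
  | doubleShuffle u v t =>
    (Convergent u ∧ Convergent v ∧ ∀ w ∈ shuffle u v, Convergent w) ∧ t.Admissible
  | eta s t => 2 ≤ s ∧ t.Admissible

instance : ∀ r : Relation, Decidable r.Valid
  | .doubleShuffle u v t => inferInstanceAs
      (Decidable ((Convergent u ∧ Convergent v ∧ ∀ w ∈ shuffle u v, Convergent w) ∧ t.Admissible))
  | .eta s t => inferInstanceAs (Decidable (2 ≤ s ∧ t.Admissible))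

theorem Lin.evalAt_singleton (p : ℤ × Index) (N : ℕ) :
    Lin.evalAt [p] N = p.1 * nestedSum p.2 N := by
  simp [Lin.evalAt]

/-- Since `Lin.evalAt_mul` is exact at every truncation, only the factors need to converge: one
tends to zero, the other to `value t`. -/
theorem Relation.tendsto_zero {r : Relation} (hr : r.Valid) :
    Tendsto r.toLin.evalAt atTop (𝓝 0) := by
  cases r with
  | doubleShuffle u v t =>
    obtain ⟨⟨hu, hv, hw⟩, ht⟩ := hr
    have h1 : Tendsto (wordsToLin ((shuffle u v).map fun w => (1, w))).evalAt atTop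
        (𝓝 (wordsToLin ((shuffle u v).map fun w => (1, w))).value) := by
      refine Lin.tendsto_evalAt fun p hp => ?_
      simp only [wordsToLin, List.map_map, List.mem_map, Function.comp_apply] at hp
      obtain ⟨w, hw', rfl⟩ := hp
      exact (hw w hw').2.2
    have h2 := ((tendsto_nestedSum hu.2.2).const_mul ((toIndex u).1 : ℝ)).mul
      ((tendsto_nestedSum hv.2.2).const_mul ((toIndex v).1 : ℝ))
    have h3 := (h1.sub h2).mul (tendsto_nestedSum ht)
    rw [value_mul_value_eq_shuffle hu hv hw, sub_self, zero_mul] at h3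
    refine h3.congr fun N => ?_
    simp only [toLin, Lin.evalAt_mul, Lin.evalAt_add, Lin.evalAt_collect, Lin.evalAt_scale,
      Lin.evalAt_singleton]
    push_cast
    ring
  | eta s t =>
    obtain ⟨hs, ht⟩ := hr
    have ha (e : Bool) : Index.Admissible [(s, e)] := ⟨Or.inl hs, by simp [Index.Pos]⟩
    have h := (((tendsto_nestedSum (ha false)).const_mul (2 ^ (s - 1) - 1 : ℝ)).add
      ((tendsto_nestedSum (ha true)).const_mul (2 ^ (s - 1) : ℝ))).mul (tendsto_nestedSum ht)
    have e : (2 ^ (s - 1) - 1 : ℝ) * value [(s, false)] + 2 ^ (s - 1) * value [(s, true)] = 0 := by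
      linear_combination eta_relation hs
    rw [e, zero_mul] at h
    refine h.congr fun N => ?_
    simp only [toLin, Lin.evalAt_mul, Lin.evalAt_cons, Lin.evalAt_nil]
    push_cast
    ring

theorem valid_certificate : ∀ p ∈ certificate, p.2.Valid := by
  decide +kernel

theorem tendsto_certificateLin {x : List (ℤ × Relation)} (hx : ∀ p ∈ x, p.2.Valid) :
    Tendsto (certificateLin x).evalAt atTop (𝓝 0) := by
  induction x with
  | nil => exact tendsto_const_nhds
  | cons p x ih =>
    have h := ((Relation.tendsto_zero (hx p List.mem_cons_self)).const_mul (p.1 : ℝ)).add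
      (ih fun q hq => hx q (List.mem_cons_of_mem _ hq))
    rw [mul_zero, add_zero] at h
    refine h.congr fun N => ?_
    change _ = Lin.evalAt (Lin.add (Lin.scale p.1 p.2.toLin) (certificateLin x)) N
    rw [Lin.evalAt_add, Lin.evalAt_scale]

theorem tendsto_targetLin : Tendsto targetLin.evalAt atTop (𝓝 0) := by
  refine (tendsto_certificateLin valid_certificate).congr fun N => ?_
  have h := Lin.evalAt_eq_zero isZero_certificate N
  rw [Lin.evalAt_add, Lin.evalAt_scale] at h
  push_cast at h
  linarith

theorem seriesLin_value : seriesLin.value =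
    193 / 64 * zeta 5 - 5 / 16 * (zeta 2 * zeta 3) - Real.log 2 ^ 5 / 15
      + 1 / 3 * Real.log 2 ^ 3 * zeta 2 - 15 / 16 * Real.log 2 * zeta 4
      - 2 * Real.log 2 * polylog 4 (1 / 2) - 2 * polylog 5 (1 / 2) := by
  have hS : Tendsto seriesLin.evalAt atTop (𝓝 seriesLin.value) :=
    Lin.tendsto_evalAt (by decide)
  have hL : Tendsto logTwoLin.evalAt atTop (𝓝 (Real.log 2)) :=
    logTwoLin_value ▸ Lin.tendsto_evalAt (by decide)
  have hZ (s : ℕ) (hs : 2 ≤ s) : Tendsto (zetaLin s).evalAt atTop (𝓝 (zeta s)) := by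
    rw [← zetaLin_value hs]
    refine Lin.tendsto_evalAt fun p hp => ?_
    rw [zetaLin, List.mem_singleton] at hp
    subst hp
    exact ⟨Or.inl hs, by simp [Index.Pos]⟩
  have h4 : Tendsto (polylogLin 4).evalAt atTop (𝓝 (polylog 4 (1 / 2))) := by
    rw [← polylogLin_value (by decide)]
    exact Lin.tendsto_evalAt (by decide)
  have h5 : Tendsto (polylogLin 5).evalAt atTop (𝓝 (polylog 5 (1 / 2))) := by
    rw [← polylogLin_value (by decide)]
    exact Lin.tendsto_evalAt (by decide)
  have h := (hS.const_mul 960).add <| ((hZ 5 (by norm_num)).const_mul (-2895)).add <|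
    (((hZ 2 le_rfl).mul (hZ 3 (by norm_num))).const_mul 300).add <|
    ((hL.mul (hL.mul (hL.mul (hL.mul hL)))).const_mul 64).add <|
    ((hL.mul (hL.mul (hL.mul (hZ 2 le_rfl)))).const_mul (-320)).add <|
    ((hL.mul (hZ 4 (by norm_num))).const_mul 900).add <|
    ((hL.mul h4).const_mul 1920).add (h5.const_mul 1920)
  -- The truncations of `targetLin` tend to zero and also, factor by factor, to `960` times the
  -- difference of the two sides.
  have h' := tendsto_nhds_unique (tendsto_targetLin.congr fun N => by
    simp only [targetLin, Lin.evalAt_add, Lin.evalAt_scale, Lin.evalAt_collect, Lin.evalAt_mul]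
    push_cast
    rfl) h
  linear_combination (-1 / 960 : ℝ) * h'

/-! ### Summation by parts for the series -/

theorem skewHarmonic_nonneg (n : ℕ) : 0 ≤ skewHarmonic n := by
  have hsucc (m : ℕ) : skewHarmonic (m + 1) = skewHarmonic m + (-1) ^ m / ((m : ℝ) + 1) :=
    Finset.sum_range_succ _ _
  have heven (k : ℕ) : 0 ≤ skewHarmonic (2 * k) := by
    induction k with
    | zero => simp [skewHarmonic]
    | succ k ih =>
      rw [show 2 * (k + 1) = 2 * k + 1 + 1 by ring, hsucc, hsucc, pow_succ, pow_mul]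
      have h : (1 : ℝ) / (2 * k + 1 + 1) ≤ 1 / (2 * k + 1) :=
        one_div_le_one_div_of_le (by positivity) (by linarith)
      push_cast
      simp only [neg_one_sq, one_pow, one_mul, neg_div]
      linarith
  rcases Nat.even_or_odd' n with ⟨k, rfl | rfl⟩
  · exact heven k
  · rw [hsucc, pow_mul]
    have := heven k
    simp only [neg_one_sq, one_pow]
    positivity

theorem skewHarmonic_eq_nestedSum (n : ℕ) : skewHarmonic n = -nestedSum [(1, true)] n := by
  rw [skewHarmonic, nestedSum_cons, ← Finset.sum_neg_distrib]
  refine Finset.sum_congr rfl fun k _ => ?_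
  simp only [term, nestedSum_nil, if_true, pow_succ]
  ring

theorem genHarmonic_eq_nestedSum (p n : ℕ) : genHarmonic p n = nestedSum [(p, false)] n := by
  simp [genHarmonic, nestedSum_cons, nestedSum_nil, term]

/-- The partial sums of `∑ skewHarmonic n / n`. -/
def skewPartialSum (N : ℕ) : ℝ := ∑ n ∈ Finset.range N, skewHarmonic (n + 1) / ((n : ℝ) + 1)

/-- The inner sum includes the diagonal, whereas nested sums are strict; the diagonal contributes
the index `(2, true)`. -/
theorem skewPartialSum_eq_nestedSum (N : ℕ) : skewPartialSum N =
    -nestedSum [(1, false), (1, true)] N - nestedSum [(2, true)] N := by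
  rw [skewPartialSum, nestedSum_cons, nestedSum_cons, ← Finset.sum_neg_distrib,
    ← Finset.sum_sub_distrib]
  refine Finset.sum_congr rfl fun n _ => ?_
  rw [skewHarmonic_eq_nestedSum, nestedSum_cons_succ]
  simp only [term, nestedSum_nil, if_true, if_false, Bool.false_eq_true]
  field_simp
  ring

theorem skewPartialSum_mono : Monotone skewPartialSum := by
  refine monotone_nat_of_le_succ fun N => ?_
  rw [skewPartialSum, skewPartialSum, Finset.sum_range_succ]
  have := skewHarmonic_nonneg (N + 1)
  have : 0 ≤ skewHarmonic (N + 1) / ((N : ℝ) + 1) := by positivity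
  linarith

theorem skewPartialSum_nonneg (N : ℕ) : 0 ≤ skewPartialSum N := by
  simpa [skewPartialSum] using skewPartialSum_mono (Nat.zero_le N)

theorem seriesLin_evalAt (N : ℕ) :
    seriesLin.evalAt N = ∑ m ∈ Finset.range N, skewPartialSum m / ((m : ℝ) + 1) ^ 3 := by
  simp only [seriesLin, Lin.evalAt_cons, Lin.evalAt_nil, nestedSum_cons (3, false)]
  rw [Finset.mul_sum, Finset.mul_sum, add_zero, ← Finset.sum_add_distrib]
  refine Finset.sum_congr rfl fun m _ => ?_
  rw [skewPartialSum_eq_nestedSum]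
  simp only [term, if_false, Bool.false_eq_true]
  push_cast
  ring

theorem tendsto_seriesLin : Tendsto seriesLin.evalAt atTop (𝓝 seriesLin.value) :=
  Lin.tendsto_evalAt (by decide)

theorem hasSum_skewPartialSum :
    HasSum (fun m : ℕ => skewPartialSum m / ((m : ℝ) + 1) ^ 3) seriesLin.value := by
  rw [hasSum_iff_tendsto_nat_of_nonneg fun m => by have := skewPartialSum_nonneg m; positivity]
  exact tendsto_seriesLin.congr seriesLin_evalAt

theorem zeta_sub_genHarmonic {p : ℕ} (hp : 2 ≤ p) (N : ℕ) :
    zeta p - genHarmonic p N = ∑' k : ℕ, 1 / (((k + N : ℕ) : ℝ) + 1) ^ p := by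
  have hs : Summable fun n : ℕ => 1 / ((n : ℝ) + 1) ^ p := by
    simpa using (summable_nat_add_iff 1).2 (Real.summable_one_div_nat_pow.2 hp)
  have hz : zeta p = ∑' n : ℕ, 1 / ((n : ℝ) + 1) ^ p := by
    have e : value [(p, false)] = zeta p := by
      rw [← zetaLin_value hp]; simp [zetaLin, Lin.value]
    have ha : Index.Admissible [(p, false)] := ⟨Or.inl hp, by simp [Index.Pos]⟩
    rw [← e]
    refine tendsto_nhds_unique (tendsto_nestedSum ha) (hs.hasSum.tendsto_sum_nat.congr fun N => ?_)
    rw [← genHarmonic_eq_nestedSum, genHarmonic]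
  rw [hz, ← hs.sum_add_tsum_nat_add N, genHarmonic, add_sub_cancel_left]

/-- The boundary term of the summation by parts. As `skewPartialSum` is monotone, moving it inside
the tail of `ζ(3)` can only increase the terms, and the result is the tail of the convergent series
in `hasSum_skewPartialSum`. -/
theorem tendsto_skewPartialSum_mul_tail :
    Tendsto (fun N => skewPartialSum N * (zeta 3 - genHarmonic 3 N)) atTop (𝓝 0) := by
  have hs : Summable fun n : ℕ => 1 / ((n : ℝ) + 1) ^ 3 := by
    simpa using (summable_nat_add_iff 1).2
      (Real.summable_one_div_nat_pow.2 (by norm_num : 1 < 3))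
  refine squeeze_zero (fun N => ?_) (fun N => ?_)
    (tendsto_sum_nat_add fun m : ℕ => skewPartialSum m / ((m : ℝ) + 1) ^ 3)
  · rw [zeta_sub_genHarmonic (by norm_num)]
    exact mul_nonneg (skewPartialSum_nonneg N) (tsum_nonneg fun k => by positivity)
  · rw [zeta_sub_genHarmonic (by norm_num), ← tsum_mul_left]
    refine Summable.tsum_le_tsum (fun k => ?_)
      (((summable_nat_add_iff N).2 hs).mul_left _)
      ((summable_nat_add_iff N).2 hasSum_skewPartialSum.summable)
    rw [mul_one_div]
    gcongr
    exact skewPartialSum_mono (Nat.le_add_left N k)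

theorem sum_eq_seriesLin_add (N : ℕ) :
    ∑ n ∈ Finset.range N, skewHarmonic (n + 1) / ((n : ℝ) + 1) * (zeta 3 - genHarmonic 3 (n + 1)) =
      seriesLin.evalAt N + skewPartialSum N * (zeta 3 - genHarmonic 3 N) := by
  rw [seriesLin_evalAt]
  induction N with
  | zero => simp [skewPartialSum]
  | succ N ih =>
    have h1 : skewPartialSum (N + 1) =
        skewPartialSum N + skewHarmonic (N + 1) / ((N : ℝ) + 1) := Finset.sum_range_succ _ _
    have h2 : genHarmonic 3 (N + 1) = genHarmonic 3 N + 1 / ((N : ℝ) + 1) ^ 3 :=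
      Finset.sum_range_succ _ _
    rw [Finset.sum_range_succ, Finset.sum_range_succ, ih, h1, h2]
    ring

/-- All terms are nonnegative, so convergence of the partial sums is enough for unconditional
summability. -/
theorem hasSum_seriesLin :
    HasSum (fun n : ℕ =>
      skewHarmonic (n + 1) / ((n : ℝ) + 1) * (zeta 3 - genHarmonic 3 (n + 1))) seriesLin.value := by
  rw [hasSum_iff_tendsto_nat_of_nonneg]
  · have h := tendsto_seriesLin.add tendsto_skewPartialSum_mul_tail
    rw [add_zero] at h
    exact h.congr fun N => (sum_eq_seriesLin_add N).symm
  · intro n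
    rw [zeta_sub_genHarmonic (by norm_num)]
    have := skewHarmonic_nonneg (n + 1)
    exact mul_nonneg (by positivity) (tsum_nonneg fun k => by positivity)

end SkewHarmonicSeries

end

theorem mainTheorem2 :
    HasSum
      (fun n : ℕ =>
        SkewHarmonicSeries.skewHarmonic (n + 1) / ((n : ℝ) + 1) *
          (SkewHarmonicSeries.zeta 3 - SkewHarmonicSeries.genHarmonic 3 (n + 1)))
      (193 / 64 * SkewHarmonicSeries.zeta 5
        - 5 / 16 * (SkewHarmonicSeries.zeta 2 * SkewHarmonicSeries.zeta 3)
        - Real.log 2 ^ 5 / 15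
        + 1 / 3 * Real.log 2 ^ 3 * SkewHarmonicSeries.zeta 2
        - 15 / 16 * Real.log 2 * SkewHarmonicSeries.zeta 4
        - 2 * Real.log 2 * SkewHarmonicSeries.polylog 4 (1 / 2)
        - 2 * SkewHarmonicSeries.polylog 5 (1 / 2)) := by
  rw [← SkewHarmonicSeries.seriesLin_value]
  exact SkewHarmonicSeries.hasSum_seriesLin
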